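/- In the total domination game on a finite simple graph $G$, two players, Dominator and Staller, alternately choose vertices of $G$; a vertex $u$ may be chosen only if it is adjacent to at least one vertex that is not yet totally dominated, where a vertex is totally dominated if it is adjacent to a vertex already chosen. The game ends when no legal move is left; Dominator wants to minimize and Staller to maximize the number of moves. Let $\gamma_{\rm tg}(G)$ be the number of moves played when Dominator starts and both players play optimally, and for a vertex $v$ let $\gamma_{\rm tg}(G|v)$ be the same number for the game in which $v$ is declared to be already totally dominated before the first move. The graph $G$ is called $\gamma_{\rm tg}$-critical if $\gamma_{\rm tg}(G|v)<\gamma_{\rm tg}(G)$ for every vertex $v$ of $G$. Theorem. For every integer $n\ge 3$, the cycle $C_n$ on $n$ vertices is $\gamma_{\rm tg}$-critical if and only if $n \bmod 6\in\{0,1,3\}$. -/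

import Mathlib

namespace TotalDominationGame

/-- The two players of the total domination game. -/
inductive Player : Type
  | dominator
  | staller

variable {V : Type*} [Fintype V] [DecidableEq V] (G : SimpleGraph V) [DecidableRel G.Adj]

/-- The legal moves in the partially total dominated graph `G|A`: the vertices that totally
dominate (that is, are adjacent to) at least one vertex outside `A`. -/
def legalMoves (A : Finset V) : Finset V :=
  Finset.univ.filter (fun u => ∃ w, G.Adj u w ∧ w ∉ A)

/-- The set of totally dominated vertices after `u` is played in `G|A`. -/
def play (A : Finset V) (u : V) : Finset V :=
  A ∪ G.neighborFinset u

/-- Every legal move leaves fewer vertices that are not totally dominated. -/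
theorem card_compl_play_lt {A : Finset V} {u : V} (hu : u ∈ legalMoves G A) :
    (play G A u)ᶜ.card < Aᶜ.card := by
  obtain ⟨w, huw, hw⟩ := (Finset.mem_filter.mp hu).2
  apply Finset.card_lt_card
  rw [Finset.ssubset_iff_of_subset]
  · exact ⟨w, by simpa using hw, by simp [play, huw]⟩
  · intro x hx
    simp only [play, Finset.mem_compl, Finset.mem_union, not_or] at hx ⊢
    exact hx.1

/-- The number of moves still to be played in `G|A` when player `p` is to move and both players
play optimally from here on: it is `0` if there is no legal move; otherwise one move is made,
which Dominator chooses so as to minimize, and Staller so as to maximize, the number of moves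
that remain afterwards, with the opponent to move. -/
def movesLeft (p : Player) (A : Finset V) : ℕ :=
  if h : (legalMoves G A).Nonempty then
    match p with
    | .dominator => 1 + (legalMoves G A).attach.inf' (Finset.attach_nonempty_iff.mpr h)
        (fun u => movesLeft .staller (play G A u.1))
    | .staller => 1 + (legalMoves G A).attach.sup' (Finset.attach_nonempty_iff.mpr h)
        (fun u => movesLeft .dominator (play G A u.1))
  else 0
termination_by Aᶜ.card
decreasing_by all_goals exact card_compl_play_lt G u.2

/-- `γ_tg(G|S)`: the number of moves in the game on `G|S` when Dominator starts and both players
play optimally. -/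
def gammaTG (S : Finset V) : ℕ :=
  movesLeft G .dominator S

/-- `G` is `γ_tg`-critical: `γ_tg(G) > γ_tg(G|v)` for every vertex `v`. -/
def IsCritical : Prop :=
  ∀ v : V, gammaTG G {v} < gammaTG G ∅

end TotalDominationGame

namespace TotalDominationGame

/-! ### Optimal play and potential arguments -/

section Strategy

variable {V : Type*} [Fintype V] [DecidableEq V] (G : SimpleGraph V) [DecidableRel G.Adj]

/-! A move `u` on the cycle dominates `u ± 1`, so the vertices split into classes under translation
by 2: one class for odd `n`, two of size `n / 2` for even `n`. In each class the vertices form a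
cycle with the moves as edges, and the classes interact only through the order of turns.

In a touched class Dominator can destroy two legal moves at once (`exists_two_moves`), while Staller
always destroys at least one; in a touched class Staller can dominate just one new vertex
(`exists_single_move`), while Dominator never dominates more than two. So the length is about two
thirds of either count. Two effects give the corrections mod 3: no class ever has exactly one legal
move (`movesIn_ne_one`), and whoever opens an untouched class loses the efficient move. The
resulting potentials give `movesLeft_le` and `le_movesLeft`.

For odd `n` they meet: the values are `(2 * n - 1) / 3` with a vertex predominated and `(2 * n + 1)
/ 3` without, which differ unless `n % 3 = 2`. For even `n`, predomination saves a move if 3 divides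
`n / 2`; otherwise `(2 * n - 1) / 3` separates the two values the wrong way. -/

theorem movesLeft_eq_zero (p : Player) {A : Finset V} (h : ¬(legalMoves G A).Nonempty) :
    movesLeft G p A = 0 := by
  rw [movesLeft, dif_neg h]

theorem movesLeft_dominator_le {A : Finset V} {u : V} (hu : u ∈ legalMoves G A) :
    movesLeft G .dominator A ≤ 1 + movesLeft G .staller (play G A u) := by
  rw [movesLeft, dif_pos ⟨u, hu⟩]
  exact Nat.add_le_add_left (Finset.inf'_le
    (fun u : {x // x ∈ legalMoves G A} => movesLeft G .staller (play G A u.1))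
    (Finset.mem_attach _ ⟨u, hu⟩)) 1

theorem exists_movesLeft_dominator_eq {A : Finset V} (h : (legalMoves G A).Nonempty) :
    ∃ u ∈ legalMoves G A,
      movesLeft G .dominator A = 1 + movesLeft G .staller (play G A u) := by
  obtain ⟨u, -, hu⟩ := Finset.exists_mem_eq_inf' (Finset.attach_nonempty_iff.mpr h)
    (fun u : {x // x ∈ legalMoves G A} => movesLeft G .staller (play G A u.1))
  refine ⟨u.1, u.2, ?_⟩
  rw [movesLeft, dif_pos h]
  exact congrArg (1 + ·) hu

theorem le_movesLeft_staller {A : Finset V} {u : V} (hu : u ∈ legalMoves G A) :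
    1 + movesLeft G .dominator (play G A u) ≤ movesLeft G .staller A := by
  conv_rhs => rw [movesLeft, dif_pos ⟨u, hu⟩]
  exact Nat.add_le_add_left (Finset.le_sup'
    (fun u : {x // x ∈ legalMoves G A} => movesLeft G .dominator (play G A u.1))
    (Finset.mem_attach _ ⟨u, hu⟩)) 1

theorem exists_movesLeft_staller_eq {A : Finset V} (h : (legalMoves G A).Nonempty) :
    ∃ u ∈ legalMoves G A,
      movesLeft G .staller A = 1 + movesLeft G .dominator (play G A u) := by
  obtain ⟨u, -, hu⟩ := Finset.exists_mem_eq_sup' (Finset.attach_nonempty_iff.mpr h)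
    (fun u : {x // x ∈ legalMoves G A} => movesLeft G .dominator (play G A u.1))
  refine ⟨u.1, u.2, ?_⟩
  rw [movesLeft, dif_pos h]
  exact congrArg (1 + ·) hu

/-- A potential that Dominator can push down by one and Staller cannot keep up bounds the length
of the game from above. -/
theorem movesLeft_le_of_potential (I : Finset V → Prop) (b : Player → Finset V → ℕ)
    (hI : ∀ A u, I A → I (play G A u))
    (hD : ∀ A, I A → (legalMoves G A).Nonempty →
      ∃ u ∈ legalMoves G A, 1 + b .staller (play G A u) ≤ b .dominator A)
    (hS : ∀ A, I A → ∀ u ∈ legalMoves G A, 1 + b .dominator (play G A u) ≤ b .staller A)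
    (p : Player) (A : Finset V) (hA : I A) : movesLeft G p A ≤ b p A := by
  induction hk : Aᶜ.card using Nat.strong_induction_on generalizing p A with
  | _ k ih =>
    subst hk
    by_cases h : (legalMoves G A).Nonempty
    · cases p with
      | dominator =>
        obtain ⟨u, hu, hb⟩ := hD A hA h
        have := ih _ (card_compl_play_lt G hu) .staller _ (hI A u hA) rfl
        have := movesLeft_dominator_le G hu
        omega
      | staller =>
        obtain ⟨u, hu, he⟩ := exists_movesLeft_staller_eq G h
        have := ih _ (card_compl_play_lt G hu) .dominator _ (hI A u hA) rfl
        have := hS A hA u hu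
        omega
    · rw [movesLeft_eq_zero G p h]
      exact Nat.zero_le _

/-- The counterpart of `movesLeft_le_of_potential` for lower bounds. -/
theorem le_movesLeft_of_potential (I : Finset V → Prop) (b : Player → Finset V → ℕ)
    (hI : ∀ A u, I A → I (play G A u))
    (h0 : ∀ p A, I A → ¬(legalMoves G A).Nonempty → b p A = 0)
    (hD : ∀ A, I A → ∀ u ∈ legalMoves G A, b .dominator A ≤ 1 + b .staller (play G A u))
    (hS : ∀ A, I A → (legalMoves G A).Nonempty →
      ∃ u ∈ legalMoves G A, b .staller A ≤ 1 + b .dominator (play G A u))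
    (p : Player) (A : Finset V) (hA : I A) : b p A ≤ movesLeft G p A := by
  induction hk : Aᶜ.card using Nat.strong_induction_on generalizing p A with
  | _ k ih =>
    subst hk
    by_cases h : (legalMoves G A).Nonempty
    · cases p with
      | staller =>
        obtain ⟨u, hu, hb⟩ := hS A hA h
        have := ih _ (card_compl_play_lt G hu) .dominator _ (hI A u hA) rfl
        have := le_movesLeft_staller G hu
        omega
      | dominator =>
        obtain ⟨u, hu, he⟩ := exists_movesLeft_dominator_eq G h
        have := ih _ (card_compl_play_lt G hu) .staller _ (hI A u hA) rfl
        have := hD A hA u hu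
        omega
    · rw [h0 p A hA h]
      exact Nat.zero_le _

end Strategy

/-! ### Arithmetic of the two potentials -/

section Numeric

/-- Upper bound for the game on two classes with `a` and `b` legal moves, where the first class is
touched, and the second one is untouched if `full` holds. -/
def upperBound (p : Player) (full : Prop) [Decidable full] (a b : ℕ) : ℕ :=
  match p with
  | .dominator =>
    if full then
      if a % 3 = 0 ∧ 0 < a ∧ b % 3 = 2 then (2 * (a + b) - 1) / 3 - 1
      else if a % 3 = 2 ∨ (a % 3 = 0 ∧ 0 < a) then (2 * (a + b) - 1) / 3
      else (2 * (a + b) + 1) / 3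
    else
      if (a % 3 = 1 ∧ b % 3 = 1) ∨ (a % 3 = 2 ∧ b % 3 = 0 ∧ 0 < b) ∨
          (b % 3 = 2 ∧ a % 3 = 0 ∧ 0 < a) then (2 * (a + b) - 1) / 3 - 1
      else (2 * (a + b) - 1) / 3
  | .staller =>
    if full then
      if a % 3 = 1 ∧ b % 3 = 2 then 2 * (a + b) / 3 - 1
      else if a % 3 = 2 then 2 * (a + b + 1) / 3
      else 2 * (a + b) / 3
    else
      if (a % 3 = 1 ∧ b % 3 = 2) ∨ (a % 3 = 2 ∧ b % 3 = 1) then 2 * (a + b) / 3 - 1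
      else 2 * (a + b) / 3

/-- Lower bound for the game on two classes with `x` and `y` vertices that are not totally
dominated, where the first class is touched, and the second one is untouched if `full` holds. -/
def lowerBound (p : Player) (full : Prop) [Decidable full] (x y : ℕ) : ℕ :=
  match p with
  | .dominator =>
    if full ∧ x % 3 = 2 then (2 * (x + y) - 1) / 3 else (2 * (x + y) + 1) / 3
  | .staller =>
    if full ∧ x % 3 = 0 then 2 * (x + y) / 3 else (2 * (x + y) + 2) / 3

variable {full full' : Prop} [Decidable full] [Decidable full'] {a b a' b' : ℕ}

theorem mod_three_cases (m : ℕ) : m % 3 = 0 ∨ m % 3 = 1 ∨ m % 3 = 2 := by omega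

/-- A count of 1 has to be excluded: in the touched case `(1, 2)` has Staller value 1, yet moving to
`(0, 2)` would leave one more move. `movesIn_ne_one` supplies the exclusion. -/
theorem upperBound_staller_fst (hf : full' ↔ full) (h : a' < a) (h2 : a ≠ 1) (h3 : b ≠ 1)
    (hfb : full → 0 < b) :
    1 + upperBound .dominator full' a' b ≤ upperBound .staller full a b := by
  by_cases hfull : full <;> simp only [upperBound, hf, hfull, if_true, if_false] <;>
    simp only [hfull, forall_true_left] at hfb <;>
    rcases mod_three_cases a with ha | ha | ha <;> rcases mod_three_cases b with hb | hb | hb <;>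
    rcases mod_three_cases a' with ha' | ha' | ha' <;> simp [ha, hb, ha'] <;>
    (try split_ifs) <;> omega

theorem upperBound_staller_snd (hf : ¬full') (h : b' < b) (h3 : b ≠ 1) :
    1 + upperBound .dominator full' a b' ≤ upperBound .staller full a b := by
  by_cases hfull : full <;> simp only [upperBound, hf, hfull, if_true, if_false] <;>
    rcases mod_three_cases a with ha | ha | ha <;> rcases mod_three_cases b with hb | hb | hb <;>
    rcases mod_three_cases b' with hb' | hb' | hb' <;> simp [ha, hb, hb'] <;>
    (try split_ifs) <;> omega

theorem upperBound_dominator_fst (hf : full' ↔ full) (h : a' + 2 ≤ a)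
    (hfb : full → 0 < b) (hc : full ∨ ¬ (a % 3 = 2 ∧ b % 3 = 0 ∧ 0 < b)) :
    1 + upperBound .staller full' a' b ≤ upperBound .dominator full a b := by
  by_cases hfull : full <;> simp only [upperBound, hf, hfull, if_true, if_false] <;>
    simp only [hfull, true_or, false_or, forall_true_left] at hc hfb <;>
    rcases mod_three_cases a with ha | ha | ha <;> rcases mod_three_cases b with hb | hb | hb <;>
    rcases mod_three_cases a' with ha' | ha' | ha' <;> simp [ha, hb, ha'] <;>
    (try split_ifs) <;> omega

/-- From residues `(2, 0)`, taking two off the second class leaves `(2, 1)`, a pair for which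
Staller's bound drops by one; two off the first would leave `(0, 0)`, which brings no gain. -/
theorem upperBound_dominator_snd (hf : ¬full') (hfull : ¬full) (h : b' + 2 ≤ b)
    (hc : a = 0 ∨ (a % 3 = 2 ∧ b % 3 = 0 ∧ 0 < b)) :
    1 + upperBound .staller full' a b' ≤ upperBound .dominator full a b := by
  simp only [upperBound, hf, hfull, if_false]
  rcases mod_three_cases a with ha | ha | ha <;> rcases mod_three_cases b with hb | hb | hb <;>
    rcases mod_three_cases b' with hb' | hb' | hb' <;> simp [ha, hb, hb'] <;>
    (try split_ifs) <;> omega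

/-- Opening an untouched class is only guaranteed to destroy one legal move; the `+ 1` in the
untouched branch pays for the loss. -/
theorem upperBound_dominator_open (hf : ¬full') (hfull : full) (h : b' < b) :
    1 + upperBound .staller full' 0 b' ≤ upperBound .dominator full 0 b := by
  simp [upperBound, hf, hfull]
  omega

theorem lowerBound_dominator_fst (hf : full' ↔ full) (h : a ≤ a' + 2) (h' : a' < a) :
    lowerBound .dominator full a b ≤ 1 + lowerBound .staller full' a' b := by
  by_cases hfull : full <;> simp only [lowerBound, hf, hfull, true_and, false_and, if_false] <;>
    rcases mod_three_cases a with ha | ha | ha <;>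
    rcases mod_three_cases a' with ha' | ha' | ha' <;> (try simp [ha, ha']) <;> omega

theorem lowerBound_dominator_snd (hf : ¬full') (h : b ≤ b' + 2) :
    lowerBound .dominator full a b ≤ 1 + lowerBound .staller full' a b' := by
  by_cases hfull : full <;> simp only [lowerBound, hf, hfull, true_and, false_and, if_false] <;>
    (try split_ifs) <;> omega

theorem lowerBound_staller_fst (hf : full' ↔ full) (h : a ≤ a' + 1) (h' : a' < a) :
    lowerBound .staller full a b ≤ 1 + lowerBound .dominator full' a' b := by
  by_cases hfull : full <;> simp only [lowerBound, hf, hfull, true_and, false_and, if_false] <;>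
    rcases mod_three_cases a with ha | ha | ha <;>
    rcases mod_three_cases a' with ha' | ha' | ha' <;> (try simp [ha, ha']) <;> omega

theorem lowerBound_staller_snd (hf : ¬full') (hfull : ¬full) (h : b ≤ b' + 1) :
    lowerBound .staller full a b ≤ 1 + lowerBound .dominator full' a b' := by
  simp only [lowerBound, hf, hfull, false_and, if_false]
  omega

/-- With the first class exhausted, Staller has to open the other one and may dominate two vertices;
the smaller value at `x % 3 = 0` accounts for this. -/
theorem lowerBound_staller_open (hf : ¬full') (hfull : full) (h : b ≤ b' + 2) :
    lowerBound .staller full 0 b ≤ 1 + lowerBound .dominator full' 0 b' := by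
  simp [lowerBound, hf, hfull]
  omega

end Numeric

/-! ### Open vertices and touched classes -/

section Classes

variable {V : Type*} [Fintype V] [DecidableEq V] (χ : V → Bool)

/-- The number of vertices of colour `i` that are not totally dominated. -/
def openIn (i : Bool) (A : Finset V) : ℕ :=
  (Finset.univ.filter (fun w => w ∉ A ∧ χ w = i)).card

/-- The class of colour `i` is nonempty and none of its vertices is totally dominated. -/
def IsUntouched (i : Bool) (A : Finset V) : Prop :=
  (∃ w, χ w = i) ∧ ∀ w, χ w = i → w ∉ A

/-- Some vertex of colour `i` is totally dominated. -/
def IsTouched (i : Bool) (A : Finset V) : Prop :=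
  ∃ w, χ w = i ∧ w ∈ A

variable {χ} {A : Finset V} {i : Bool}

theorem openIn_pos_iff : 0 < openIn χ i A ↔ ∃ w, χ w = i ∧ w ∉ A := by
  rw [openIn, Finset.card_pos]
  simp only [Finset.Nonempty, Finset.mem_filter, Finset.mem_univ, true_and, and_comm]

omit [Fintype V] [DecidableEq V] in
theorem isTouched_of_not_isUntouched (hu : ¬IsUntouched χ i A) (hw : ∃ w, χ w = i ∧ w ∉ A) :
    IsTouched χ i A := by
  obtain ⟨w, hi, -⟩ := hw
  by_contra hcon
  exact hu ⟨⟨w, hi⟩, fun x hx hxA => hcon ⟨x, hx, hxA⟩⟩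

end Classes

/-! ### The game on the cosets of the subgroup generated by `2t` -/

section Circulant

variable {V : Type*} [AddCommGroup V] [Fintype V] [DecidableEq V]

/-- In `G`, the neighbours of `u` are `u ± t`, and the fibres of `χ` are the cosets of the
subgroup generated by `2t`. -/
structure IsCirculant (G : SimpleGraph V) (t : V) (χ : V → Bool) : Prop where
  adj_iff : ∀ u v, G.Adj u v ↔ v = u + t ∨ v = u - t
  two_ne : t + t ≠ 0
  color_iff : ∀ x y, χ x = χ y ↔ ∃ k : ℕ, y = x + k • (t + t)

theorem IsCirculant.color_add {V : Type*} [AddCommGroup V] {G : SimpleGraph V} {t : V}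
    {χ : V → Bool} (h : IsCirculant G t χ) (x : V) : χ (x + (t + t)) = χ x :=
  ((h.color_iff _ _).2 ⟨1, by simp⟩).symm

theorem IsCirculant.color_sub {V : Type*} [AddCommGroup V] {G : SimpleGraph V} {t : V}
    {χ : V → Bool} (h : IsCirculant G t χ) (u : V) : χ (u - t) = χ (u + t) :=
  (h.color_iff _ _).2 ⟨1, by simp only [one_smul]; abel⟩

variable (G : SimpleGraph V) [DecidableRel G.Adj] (t : V) (χ : V → Bool)

/-- The number of legal moves whose neighbours have colour `i`. -/
def movesIn (i : Bool) (A : Finset V) : ℕ :=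
  ((legalMoves G A).filter (fun u => χ (u + t) = i)).card

variable {G t χ} {A : Finset V} {u : V} {i : Bool}

namespace IsCirculant

variable (h : IsCirculant G t χ)
include h

theorem mem_legalMoves : u ∈ legalMoves G A ↔ u + t ∉ A ∨ u - t ∉ A := by
  simp only [legalMoves, Finset.mem_filter, Finset.mem_univ, true_and, h.adj_iff]
  constructor
  · rintro ⟨w, rfl | rfl, hw⟩ <;> simp [hw]
  · rintro (hw | hw)
    exacts [⟨_, .inl rfl, hw⟩, ⟨_, .inr rfl, hw⟩]

theorem mem_play {w : V} : w ∈ play G A u ↔ w ∈ A ∨ w = u + t ∨ w = u - t := by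
  simp [play, h.adj_iff]

theorem movesIn_play_lt (hu : u ∈ legalMoves G A) :
    movesIn G t χ (χ (u + t)) (play G A u) < movesIn G t χ (χ (u + t)) A := by
  apply Finset.card_lt_card
  rw [Finset.ssubset_iff_of_subset]
  · refine ⟨u, by simp [hu], ?_⟩
    simp [h.mem_legalMoves, h.mem_play]
  · intro x
    simp only [Finset.mem_filter, h.mem_legalMoves, h.mem_play]
    tauto

theorem movesIn_play_of_ne (hi : χ (u + t) ≠ i) :
    movesIn G t χ i (play G A u) = movesIn G t χ i A := by
  unfold movesIn
  congr 1
  ext x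
  simp only [Finset.mem_filter, h.mem_legalMoves, h.mem_play]
  refine and_congr_left fun hx => ?_
  have hu := h.color_sub u
  have hx' := h.color_sub x
  have h1 : x + t ≠ u + t := fun e => hi (by rw [← e, hx])
  have h2 : x + t ≠ u - t := fun e => hi (by rw [← hu, ← e, hx])
  have h3 : x - t ≠ u + t := fun e => hi (by rw [← e, hx', hx])
  have h4 : x - t ≠ u - t := fun e => hi (by rw [← hu, ← e, hx', hx])
  simp [h1, h2, h3, h4]

theorem openIn_play_of_ne (hi : χ (u + t) ≠ i) :
    openIn χ i (play G A u) = openIn χ i A := by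
  unfold openIn
  congr 1
  ext x
  simp only [Finset.mem_filter, Finset.mem_univ, true_and, h.mem_play]
  refine and_congr_left fun hx => ?_
  have hu := h.color_sub u
  have h1 : x ≠ u + t := fun e => hi (by rw [← e, hx])
  have h2 : x ≠ u - t := fun e => hi (by rw [← hu, ← e, hx])
  simp [h1, h2]

theorem openIn_play_lt (hu : u ∈ legalMoves G A) :
    openIn χ (χ (u + t)) (play G A u) < openIn χ (χ (u + t)) A := by
  apply Finset.card_lt_card
  rw [Finset.ssubset_iff_of_subset]
  · rcases h.mem_legalMoves.1 hu with hw | hw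
    · exact ⟨u + t, by simp [hw], by simp [h.mem_play]⟩
    · exact ⟨u - t, by simp [hw, h.color_sub], by simp [h.mem_play]⟩
  · intro x
    simp only [Finset.mem_filter, h.mem_play]
    tauto

theorem openIn_le_play_add_two : openIn χ i A ≤ openIn χ i (play G A u) + 2 := by
  refine (Finset.card_le_card (t := Finset.univ.filter (fun w => w ∉ play G A u ∧ χ w = i) ∪
    {u + t, u - t}) fun w hw => ?_).trans ((Finset.card_union_le _ _).trans
      (Nat.add_le_add_left Finset.card_le_two _))
  simp only [Finset.mem_union, Finset.mem_filter, Finset.mem_univ, true_and, h.mem_play,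
    Finset.mem_insert, Finset.mem_singleton] at hw ⊢
  tauto

/-- An open vertex `w` makes both `w - t` and `w + t` legal; these are distinct because `2t ≠ 0`,
and they belong to the same class. -/
theorem movesIn_ne_one : movesIn G t χ i A ≠ 1 := by
  intro h1
  obtain ⟨u, hu⟩ := Finset.card_eq_one.1 h1
  have huniq : ∀ x, (x + t ∉ A ∨ x - t ∉ A) → χ (x + t) = i → x = u := fun x hx hi => by
    have : x ∈ (legalMoves G A).filter (fun u => χ (u + t) = i) :=
      Finset.mem_filter.2 ⟨h.mem_legalMoves.2 hx, hi⟩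
    simpa [hu] using this
  have hmem : u ∈ (legalMoves G A).filter (fun u => χ (u + t) = i) := by simp [hu]
  obtain ⟨hl, hi⟩ := Finset.mem_filter.1 hmem
  rcases h.mem_legalMoves.1 hl with hw | hw
  · have := huniq (u + (t + t)) (.inr (by rwa [show u + (t + t) - t = u + t by abel]))
      (by rw [show u + (t + t) + t = u + t + (t + t) by abel, h.color_add, hi])
    exact h.two_ne (by simpa using this)
  · have := huniq (u - (t + t)) (.inl (by rwa [show u - (t + t) + t = u - t by abel]))
      (by rw [show u - (t + t) + t = u - t by abel, h.color_sub, hi])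
    exact h.two_ne (by simpa using this)

omit [DecidableRel G.Adj] in
-- Steps of `2t` lead from any open vertex to a dominated one of the same class, so some step
-- crosses over.
theorem exists_boundary (ht : IsTouched χ i A) (ho : ∃ w, χ w = i ∧ w ∉ A) :
    ∃ w, χ w = i ∧ w ∉ A ∧ w + (t + t) ∈ A := by
  obtain ⟨x, hx, hxA⟩ := ht
  obtain ⟨y, hy, hyA⟩ := ho
  by_contra! hcon
  obtain ⟨k, hk⟩ := (h.color_iff y x).1 (hy.trans hx.symm)
  have key : ∀ k : ℕ, χ (y + k • (t + t)) = i ∧ y + k • (t + t) ∉ A := by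
    intro k
    induction k with
    | zero => simpa using ⟨hy, hyA⟩
    | succ k ih =>
      rw [succ_nsmul, ← add_assoc]
      exact ⟨by rw [h.color_add, ih.1], hcon _ ih.1 ih.2⟩
  exact (key k).2 (hk ▸ hxA)

theorem movesIn_pos_iff : 0 < movesIn G t χ i A ↔ ∃ w, χ w = i ∧ w ∉ A := by
  rw [movesIn, Finset.card_pos]
  constructor
  · rintro ⟨u, hu⟩
    obtain ⟨hl, hi⟩ := Finset.mem_filter.1 hu
    rcases h.mem_legalMoves.1 hl with hw | hw
    exacts [⟨_, hi, hw⟩, ⟨_, (h.color_sub u).trans hi, hw⟩]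
  · rintro ⟨w, hi, hw⟩
    exact ⟨w - t, Finset.mem_filter.2 ⟨h.mem_legalMoves.2 (by simp [hw]), by simpa using hi⟩⟩

theorem exists_legal (hw : ∃ w, χ w = i ∧ w ∉ A) : ∃ u ∈ legalMoves G A, χ (u + t) = i := by
  obtain ⟨w, hi, hw⟩ := hw
  exact ⟨w - t, h.mem_legalMoves.2 (by simp [hw]), by simpa using hi⟩

/-- At a boundary `w`, with `w + 2t` dominated, playing `w - t` also kills `w + t`, whose neighbours
are `w` and `w + 2t`. -/
theorem exists_two_moves (ht : IsTouched χ i A) (ho : 0 < movesIn G t χ i A) :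
    ∃ u ∈ legalMoves G A, χ (u + t) = i ∧
      movesIn G t χ i (play G A u) + 2 ≤ movesIn G t χ i A := by
  obtain ⟨w, hi, hw, hw'⟩ := h.exists_boundary ht (h.movesIn_pos_iff.1 ho)
  refine ⟨w - t, h.mem_legalMoves.2 (by simp [hw]), by simpa using hi, ?_⟩
  have hne : w - t ≠ w + t := fun e => h.two_ne (by
    rw [sub_eq_iff_eq_add, add_assoc, left_eq_add] at e
    exact e)
  have hd : Disjoint ((legalMoves G (play G A (w - t))).filter (fun u => χ (u + t) = i))
      {w - t, w + t} := by
    rw [Finset.disjoint_right]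
    intro x hx
    simp only [Finset.mem_insert, Finset.mem_singleton] at hx
    rcases hx with rfl | rfl
    · simp [h.mem_legalMoves, h.mem_play]
    · simp [h.mem_legalMoves, h.mem_play, hw', add_assoc]
  have hc := Finset.card_union_of_disjoint hd
  rw [Finset.card_pair hne] at hc
  refine (hc.symm.le.trans (Finset.card_le_card ?_))
  intro x hx
  simp only [Finset.mem_union, Finset.mem_filter, Finset.mem_insert, Finset.mem_singleton,
    h.mem_legalMoves, h.mem_play] at hx ⊢
  rcases hx with ⟨hx, hxi⟩ | rfl | rfl
  · tauto
  · simpa [hw] using hi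
  · refine ⟨.inr (by simpa using hw), ?_⟩
    rw [add_assoc, h.color_add, hi]

/-- At the same boundary, `w + t` wastes its second neighbour `w + 2t`. -/
theorem exists_single_move (ht : IsTouched χ i A) (ho : 0 < openIn χ i A) :
    ∃ u ∈ legalMoves G A, χ (u + t) = i ∧ openIn χ i A ≤ openIn χ i (play G A u) + 1 := by
  obtain ⟨w, hi, hw, hw'⟩ := h.exists_boundary ht (openIn_pos_iff.1 ho)
  refine ⟨w + t, h.mem_legalMoves.2 (by simp [hw]), by rw [add_assoc, h.color_add, hi], ?_⟩
  refine (Finset.card_le_card (t := Finset.univ.filter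
    (fun x => x ∉ play G A (w + t) ∧ χ x = i) ∪ {w}) fun x hx => ?_).trans
      (Finset.card_union_le _ _)
  simp only [Finset.mem_union, Finset.mem_filter, Finset.mem_univ, true_and, h.mem_play,
    Finset.mem_singleton, add_sub_cancel_right, add_assoc] at hx ⊢
  by_cases hxw : x = w + (t + t)
  · exact absurd (hxw ▸ hw') hx.1
  · tauto

theorem isTouched_play (ht : IsTouched χ i A) : IsTouched χ i (play G A u) := by
  obtain ⟨w, hi, hw⟩ := ht
  exact ⟨w, hi, h.mem_play.2 (.inl hw)⟩

theorem isTouched_play_self : IsTouched χ (χ (u + t)) (play G A u) :=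
  ⟨u + t, rfl, h.mem_play.2 (by simp)⟩

theorem isUntouched_play_of_ne (hi : χ (u + t) ≠ i) :
    IsUntouched χ i (play G A u) ↔ IsUntouched χ i A := by
  refine and_congr_right fun _ => forall₂_congr fun w hw => not_congr ?_
  have h1 : w ≠ u + t := fun e => hi (by rw [← e, hw])
  have h2 : w ≠ u - t := fun e => hi (by rw [← h.color_sub u, ← e, hw])
  simp [h.mem_play, h1, h2]

theorem not_isUntouched_play_self : ¬IsUntouched χ (χ (u + t)) (play G A u) :=
  fun hu => hu.2 _ rfl (h.mem_play.2 (by simp))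

theorem exists_open_of_legalMoves (hl : (legalMoves G A).Nonempty) :
    (∃ w, χ w = i ∧ w ∉ A) ∨ ∃ w, χ w = !i ∧ w ∉ A := by
  obtain ⟨u, hu⟩ := hl
  have : ∃ w, w ∉ A := by
    rcases h.mem_legalMoves.1 hu with hw | hw
    exacts [⟨_, hw⟩, ⟨_, hw⟩]
  obtain ⟨w, hw⟩ := this
  by_cases hi : χ w = i
  · exact .inl ⟨w, hi, hw⟩
  · exact .inr ⟨w, Bool.eq_not_of_ne hi, hw⟩

open Classical in
theorem movesLeft_le (p : Player) (ht : IsTouched χ i A) :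
    movesLeft G p A ≤
      upperBound p (IsUntouched χ (!i) A) (movesIn G t χ i A) (movesIn G t χ (!i) A) := by
  refine movesLeft_le_of_potential G (IsTouched χ i) (fun p A =>
    upperBound p (IsUntouched χ (!i) A) (movesIn G t χ i A) (movesIn G t χ (!i) A))
    (fun A u => h.isTouched_play) ?_ ?_ p A ht
  · intro A ht hl
    have hfb : IsUntouched χ (!i) A → 0 < movesIn G t χ (!i) A := fun hf =>
      h.movesIn_pos_iff.2 (hf.1.imp fun w hw => ⟨hw, hf.2 w hw⟩)
    have hfst : 0 < movesIn G t χ i A → (IsUntouched χ (!i) A ∨ ¬ (movesIn G t χ i A % 3 = 2 ∧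
        movesIn G t χ (!i) A % 3 = 0 ∧ 0 < movesIn G t χ (!i) A)) → ∃ u ∈ legalMoves G A,
        1 + upperBound .staller (IsUntouched χ (!i) (play G A u)) (movesIn G t χ i (play G A u))
          (movesIn G t χ (!i) (play G A u)) ≤ upperBound .dominator (IsUntouched χ (!i) A)
            (movesIn G t χ i A) (movesIn G t χ (!i) A) := by
      intro ha hc
      obtain ⟨u, hu, hi, hle⟩ := h.exists_two_moves ht ha
      have hne : χ (u + t) ≠ !i := by simp [hi]
      refine ⟨u, hu, ?_⟩
      rw [h.movesIn_play_of_ne hne]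
      exact upperBound_dominator_fst (h.isUntouched_play_of_ne hne) hle hfb hc
    by_cases hf : IsUntouched χ (!i) A
    · rcases Nat.eq_zero_or_pos (movesIn G t χ i A) with ha | ha
      · obtain ⟨u, hu, hi⟩ := h.exists_legal (h.movesIn_pos_iff.1 (hfb hf))
        have hne : χ (u + t) ≠ i := by simp [hi]
        refine ⟨u, hu, ?_⟩
        have h1 := h.movesIn_play_lt hu
        have h2 := h.not_isUntouched_play_self (A := A) (u := u)
        rw [hi] at h1 h2
        simp only [h.movesIn_play_of_ne hne, ha]
        exact upperBound_dominator_open h2 hf h1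
      · exact hfst ha (.inl hf)
    -- Dominator plays in the first class, except when it is exhausted or when the residues `(2, 0)`
    -- make the second class profitable.
    · by_cases hc : movesIn G t χ i A = 0 ∨ (movesIn G t χ i A % 3 = 2 ∧
        movesIn G t χ (!i) A % 3 = 0 ∧ 0 < movesIn G t χ (!i) A)
      · have hb : 0 < movesIn G t χ (!i) A := by
          rcases hc with ha | hc
          · rw [h.movesIn_pos_iff]
            refine (h.exists_open_of_legalMoves (i := i) hl).resolve_left fun hw => ?_
            exact ha.not_gt (h.movesIn_pos_iff.2 hw)
          · exact hc.2.2
        obtain ⟨u, hu, hi, hle⟩ := h.exists_two_moves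
          (isTouched_of_not_isUntouched hf (h.movesIn_pos_iff.1 hb)) hb
        have hne : χ (u + t) ≠ i := by simp [hi]
        have h2 := h.not_isUntouched_play_self (A := A) (u := u)
        rw [hi] at h2
        refine ⟨u, hu, ?_⟩
        simp only [h.movesIn_play_of_ne hne]
        exact upperBound_dominator_snd h2 hf hle hc
      · exact hfst (by omega) (.inr (by omega))
  · intro A ht u hu
    have hlt := h.movesIn_play_lt hu
    by_cases hi : χ (u + t) = i
    · have hne : χ (u + t) ≠ !i := by simp [hi]
      rw [hi] at hlt
      simp only [h.movesIn_play_of_ne hne]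
      exact upperBound_staller_fst (h.isUntouched_play_of_ne hne) hlt h.movesIn_ne_one
        h.movesIn_ne_one fun hf =>
          h.movesIn_pos_iff.2 (hf.1.imp fun w hw => ⟨hw, hf.2 w hw⟩)
    · have h2 := h.not_isUntouched_play_self (A := A) (u := u)
      simp only [h.movesIn_play_of_ne hi]
      rw [Bool.eq_not_of_ne hi] at hlt h2
      exact upperBound_staller_snd h2 hlt h.movesIn_ne_one

open Classical in
theorem le_movesLeft (p : Player) (ht : IsTouched χ i A) :
    lowerBound p (IsUntouched χ (!i) A) (openIn χ i A) (openIn χ (!i) A) ≤ movesLeft G p A := by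
  refine le_movesLeft_of_potential G (IsTouched χ i) (fun p A =>
    lowerBound p (IsUntouched χ (!i) A) (openIn χ i A) (openIn χ (!i) A))
    (fun A u => h.isTouched_play) ?_ ?_ ?_ p A ht
  · intro p A ht hl
    have hz : ∀ j, openIn χ j A = 0 := fun j => by
      by_contra hj
      obtain ⟨u, hu, -⟩ := h.exists_legal (openIn_pos_iff.1 (Nat.pos_of_ne_zero hj))
      exact hl ⟨u, hu⟩
    cases p <;> simp [lowerBound, hz]
  · intro A ht u hu
    have hle := h.openIn_le_play_add_two (A := A) (u := u) (i := χ (u + t))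
    by_cases hi : χ (u + t) = i
    · have hne : χ (u + t) ≠ !i := by simp [hi]
      have hlt := h.openIn_play_lt hu
      rw [hi] at hle hlt
      simp only [h.openIn_play_of_ne hne]
      exact lowerBound_dominator_fst (h.isUntouched_play_of_ne hne) hle hlt
    · have h2 := h.not_isUntouched_play_self (A := A) (u := u)
      simp only [h.openIn_play_of_ne hi]
      rw [Bool.eq_not_of_ne hi] at hle h2
      exact lowerBound_dominator_snd h2 hle
  · intro A ht hl
    rcases Nat.eq_zero_or_pos (openIn χ i A) with ha | ha
    · have hb := (h.exists_open_of_legalMoves (i := i) hl).resolve_left fun hw =>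
        ha.not_gt (openIn_pos_iff.2 hw)
      by_cases hf : IsUntouched χ (!i) A
      · obtain ⟨u, hu, hi⟩ := h.exists_legal hb
        have hne : χ (u + t) ≠ i := by simp [hi]
        have h2 := h.not_isUntouched_play_self (A := A) (u := u)
        rw [hi] at h2
        refine ⟨u, hu, ?_⟩
        simp only [h.openIn_play_of_ne hne, ha]
        exact lowerBound_staller_open h2 hf h.openIn_le_play_add_two
      · obtain ⟨u, hu, hi, hle⟩ := h.exists_single_move
          (isTouched_of_not_isUntouched hf hb) (openIn_pos_iff.2 hb)
        have hne : χ (u + t) ≠ i := by simp [hi]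
        have h2 := h.not_isUntouched_play_self (A := A) (u := u)
        rw [hi] at h2
        refine ⟨u, hu, ?_⟩
        simp only [h.openIn_play_of_ne hne]
        exact lowerBound_staller_snd h2 hf hle
    · obtain ⟨u, hu, hi, hle⟩ := h.exists_single_move ht ha
      have hne : χ (u + t) ≠ !i := by simp [hi]
      have hlt := h.openIn_play_lt hu
      rw [hi] at hlt
      refine ⟨u, hu, ?_⟩
      simp only [h.openIn_play_of_ne hne]
      exact lowerBound_staller_fst (h.isUntouched_play_of_ne hne) hle hlt

end IsCirculant

end Circulant

/-- The value does not depend on the `Decidable` instance, so `full` can be replaced by an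
equivalent proposition. -/
theorem upperBound_congr {p : Player} {full full' : Prop} [Decidable full] [Decidable full']
    (hf : full ↔ full') (a b : ℕ) : upperBound p full a b = upperBound p full' a b := by
  obtain rfl := propext hf
  congr

theorem lowerBound_congr {p : Player} {full full' : Prop} [Decidable full] [Decidable full']
    (hf : full ↔ full') (x y : ℕ) : lowerBound p full x y = lowerBound p full' x y := by
  obtain rfl := propext hf
  congr

/-! ### Open vertices at the starting positions -/

section Classes

variable {V : Type*} [Fintype V] [DecidableEq V] {χ : V → Bool} {i : Bool}

theorem isUntouched_empty_iff : IsUntouched χ i ∅ ↔ 0 < openIn χ i ∅ := by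
  simp [IsUntouched, openIn_pos_iff]

theorem isUntouched_singleton_iff (v : V) :
    IsUntouched χ (!χ v) {v} ↔ 0 < openIn χ (!χ v) ∅ := by
  rw [← isUntouched_empty_iff, IsUntouched, IsUntouched]
  refine and_congr_right fun _ => forall₂_congr fun w hw => ?_
  have : w ≠ v := fun e => by simp [e] at hw
  simp [this]

theorem openIn_singleton_not (v : V) : openIn χ (!χ v) {v} = openIn χ (!χ v) ∅ := by
  unfold openIn
  congr 1
  ext w
  simp only [Finset.mem_filter, Finset.mem_singleton, Finset.notMem_empty]
  have : χ w = (!χ v) → w ≠ v := fun hw e => by simp [e] at hw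
  tauto

theorem openIn_empty_le_singleton (v : V) :
    openIn χ (χ v) ∅ ≤ openIn χ (χ v) {v} + 1 := by
  refine (Finset.card_le_card (t := Finset.univ.filter (fun w => w ∉ ({v} : Finset V) ∧
    χ w = χ v) ∪ {v}) fun w hw => ?_).trans (Finset.card_union_le _ _)
  simp only [Finset.mem_union, Finset.mem_filter, Finset.mem_singleton] at hw ⊢
  tauto

theorem openIn_singleton_lt (v : V) : openIn χ (χ v) {v} < openIn χ (χ v) ∅ := by
  apply Finset.card_lt_card
  rw [Finset.ssubset_iff_of_subset]
  · exact ⟨v, by simp, by simp⟩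
  · intro w
    simp only [Finset.mem_filter, Finset.notMem_empty]
    tauto

end Classes

/-! ### Values of the two starting positions and criticality -/

section Start

variable {V : Type*} [AddCommGroup V] [Fintype V] [DecidableEq V] {G : SimpleGraph V}
  [DecidableRel G.Adj] {t : V} {χ : V → Bool} {i : Bool}

/-- Translation by `t` injects the legal moves of a class into its vertices. -/
theorem movesIn_le_openIn_empty (A : Finset V) : movesIn G t χ i A ≤ openIn χ i ∅ :=
  Finset.card_le_card_of_injOn (· + t) (fun u hu => by simpa using (Finset.mem_filter.1 hu).2)
    (fun _ _ _ _ e => add_right_cancel e)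

namespace IsCirculant

variable (h : IsCirculant G t χ)
include h

open Classical in
theorem gammaTG_singleton_le (v : V) : ∃ a ≤ openIn χ (χ v) ∅, ∃ b ≤ openIn χ (!χ v) ∅,
    gammaTG G {v} ≤ upperBound .dominator (0 < openIn χ (!χ v) ∅) a b :=
  ⟨_, movesIn_le_openIn_empty {v}, _, movesIn_le_openIn_empty {v},
    (h.movesLeft_le .dominator ⟨v, rfl, by simp⟩).trans_eq
      (upperBound_congr (isUntouched_singleton_iff v) _ _)⟩

theorem le_gammaTG_singleton (v : V) : ∃ x, x + 1 = openIn χ (χ v) ∅ ∧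
    lowerBound .dominator (0 < openIn χ (!χ v) ∅) x (openIn χ (!χ v) ∅) ≤ gammaTG G {v} := by
  refine ⟨openIn χ (χ v) {v}, ?_, ?_⟩
  · have := openIn_singleton_lt (χ := χ) v
    have := openIn_empty_le_singleton (χ := χ) v
    omega
  · classical
    have := h.le_movesLeft .dominator (A := {v}) ⟨v, rfl, by simp⟩
    rwa [openIn_singleton_not, lowerBound_congr (isUntouched_singleton_iff v)] at this

open Classical in
theorem gammaTG_empty_le : ∃ i, ∃ a < openIn χ i ∅, ∃ b ≤ openIn χ (!i) ∅, a ≠ 1 ∧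
    gammaTG G ∅ ≤ 1 + upperBound .staller (0 < openIn χ (!i) ∅) a b := by
  have h0 : (0 : V) ∈ legalMoves G ∅ := by simp [h.mem_legalMoves]
  have hne : χ (0 + t) ≠ !χ (0 + t) := by simp
  refine ⟨χ (0 + t), _, (h.movesIn_play_lt h0).trans_le (movesIn_le_openIn_empty _), _,
    movesIn_le_openIn_empty (G := G) (t := t) (play G ∅ 0), h.movesIn_ne_one,
    (movesLeft_dominator_le G h0).trans (Nat.add_le_add_left ?_ 1)⟩
  exact (h.movesLeft_le .staller h.isTouched_play_self).trans_eq
    (upperBound_congr ((h.isUntouched_play_of_ne hne).trans isUntouched_empty_iff) _ _)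

theorem le_gammaTG_empty : ∃ i, ∃ x < openIn χ i ∅, openIn χ i ∅ ≤ x + 2 ∧
    1 + lowerBound .staller (0 < openIn χ (!i) ∅) x (openIn χ (!i) ∅) ≤ gammaTG G ∅ := by
  have h0 : (0 : V) ∈ legalMoves G ∅ := by simp [h.mem_legalMoves]
  obtain ⟨u, hu, he⟩ := exists_movesLeft_dominator_eq G ⟨0, h0⟩
  have hne : χ (u + t) ≠ !χ (u + t) := by simp
  refine ⟨χ (u + t), _, h.openIn_play_lt hu, h.openIn_le_play_add_two, ?_⟩
  rw [gammaTG, he]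
  refine Nat.add_le_add_left ?_ 1
  classical
  have := h.le_movesLeft .staller (h.isTouched_play_self (A := ∅) (u := u))
  rwa [h.openIn_play_of_ne hne, lowerBound_congr
    ((h.isUntouched_play_of_ne hne).trans isUntouched_empty_iff)] at this

theorem isCritical_iff_of_one_class {n : ℕ} (hn : 3 ≤ n) (hodd : n % 2 = 1)
    (hf : openIn χ false ∅ = n) (ht : openIn χ true ∅ = 0) :
    IsCritical G ↔ n % 6 = 0 ∨ n % 6 = 1 ∨ n % 6 = 3 := by
  have hχ : ∀ v, χ v = false := fun v => by
    by_contra hv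
    exact ht.not_gt (openIn_pos_iff.2 ⟨v, by simpa using hv, by simp⟩)
  have key : ∀ v, gammaTG G {v} = (2 * n - 1) / 3 := fun v => by
    obtain ⟨a, ha, b, hb, hle⟩ := h.gammaTG_singleton_le v
    obtain ⟨x, hx, hge⟩ := h.le_gammaTG_singleton v
    simp only [hχ, Bool.not_false, hf, ht, Nat.lt_irrefl, nonpos_iff_eq_zero] at ha hb hle hx hge
    subst hb
    simp [upperBound] at hle
    simp [lowerBound] at hge
    omega
  have key' : gammaTG G ∅ = (2 * n + 1) / 3 := by
    obtain ⟨i, a, ha, b, hb, -, hle⟩ := h.gammaTG_empty_le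
    obtain ⟨j, x, hx, hx', hge⟩ := h.le_gammaTG_empty
    cases i
    · cases j
      · simp only [Bool.not_false, hf, ht, Nat.lt_irrefl, nonpos_iff_eq_zero] at ha hb hle hx hx' hge
        subst hb
        simp [upperBound] at hle
        simp [lowerBound] at hge
        omega
      · omega
    · omega
  simp only [IsCritical, key, key', forall_const]
  omega

theorem isCritical_iff_of_two_classes {n L : ℕ} (hL : 2 ≤ L) (hn : n = 2 * L)
    (hc : ∀ i, openIn χ i ∅ = L) :
    IsCritical G ↔ n % 6 = 0 ∨ n % 6 = 1 ∨ n % 6 = 3 := by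
  -- The costly `+ 1` branch requires `a = 0` or `a % 3 = 1`, hence `a ≤ L - 2` when 3 divides `L`.
  have h1 : ∀ v, L % 3 = 0 → gammaTG G {v} + 1 ≤ 2 * n / 3 := fun v h3 => by
    obtain ⟨a, ha, b, hb, hle⟩ := h.gammaTG_singleton_le v
    simp only [hc, show 0 < L by omega] at ha hb hle
    simp only [upperBound, if_true] at hle
    rcases mod_three_cases a with ha' | ha' | ha' <;> simp [ha'] at hle <;>
      (try split_ifs at hle) <;> omega
  have h2 : ∀ v, L % 3 ≠ 0 → (2 * n - 1) / 3 ≤ gammaTG G {v} := fun v h3 => by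
    obtain ⟨x, hx, hge⟩ := h.le_gammaTG_singleton v
    simp only [hc, show 0 < L by omega] at hx hge
    simp only [lowerBound] at hge
    split_ifs at hge <;> omega
  -- Dominator's opening leaves `x = L - 1` or `x = L - 2`, neither divisible by 3, so Staller's
  -- bound is not reduced.
  have h3 : L % 3 = 0 → 2 * n / 3 ≤ gammaTG G ∅ := fun h3 => by
    obtain ⟨i, x, hx, hx', hge⟩ := h.le_gammaTG_empty
    simp only [hc, show 0 < L by omega] at hx hx' hge
    simp only [lowerBound] at hge
    split_ifs at hge <;> omega
  have h4 : L % 3 ≠ 0 → gammaTG G ∅ ≤ (2 * n - 1) / 3 := fun h3 => by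
    obtain ⟨i, a, ha, b, hb, ha1, hle⟩ := h.gammaTG_empty_le
    simp only [hc, show 0 < L by omega] at ha hb hle
    simp only [upperBound, if_true] at hle
    rcases mod_three_cases a with ha' | ha' | ha' <;>
      rcases mod_three_cases b with hb' | hb' | hb' <;>
      rcases mod_three_cases L with hl | hl | hl <;> simp [ha', hb'] at hle <;> omega
  constructor
  · intro hcrit
    by_contra hmod
    have := hcrit 0
    have := h2 0 (by omega)
    have := h4 (by omega)
    omega
  · intro hmod v
    have := h1 v (by omega)
    have := h3 (by omega)
    omega

end IsCirculant

end Start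

/-! ### Cycles as circulants -/

section CycleGraph

variable {m : ℕ}

theorem adj_cycleGraph_iff (u v : Fin (m + 3)) :
    (SimpleGraph.cycleGraph (m + 3)).Adj u v ↔ v = u + 1 ∨ v = u - 1 := by
  rw [SimpleGraph.cycleGraph_adj, sub_eq_iff_eq_add, sub_eq_iff_eq_add, eq_sub_iff_add_eq,
    or_comm, add_comm 1 u, add_comm 1 v, eq_comm (a := u)]

theorem val_nsmul_two (k : ℕ) : (k • (1 + 1) : Fin (m + 3)).val = 2 * k % (m + 3) := by
  induction k with
  | zero => simp
  | succ k ih =>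
    rw [succ_nsmul, Fin.val_add, ih, Fin.val_add, Fin.val_one, Nat.mod_add_mod, Nat.add_mod_mod,
      mul_add_one]

theorem one_add_one_ne_zero_fin : (1 + 1 : Fin (m + 3)) ≠ 0 := by
  intro e
  have h1 := val_nsmul_two (m := m) 1
  rw [one_nsmul, e, mul_one, Nat.mod_eq_of_lt (by omega)] at h1
  simp at h1

theorem isCirculant_cycleGraph_odd (hm : m % 2 = 0) :
    IsCirculant (SimpleGraph.cycleGraph (m + 3)) 1 (fun _ => false) where
  adj_iff := adj_cycleGraph_iff
  two_ne := one_add_one_ne_zero_fin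
  color_iff x y := by
    -- For even `m`, `(m + 4) / 2` is the inverse of 2 modulo `m + 3`.
    refine iff_of_true rfl ⟨(y - x).val * ((m + 4) / 2), ?_⟩
    rw [← sub_eq_iff_eq_add']
    ext
    rw [val_nsmul_two, mul_left_comm, show 2 * ((m + 4) / 2) = (m + 3) + 1 by omega, mul_add_one,
      Nat.mul_add_mod_self_right, Nat.mod_eq_of_lt (y - x).isLt]

theorem val_add_mod_two (hm : m % 2 = 1) (x y : Fin (m + 3)) :
    (x + y).val % 2 = (x.val + y.val) % 2 := by
  rw [Fin.val_add, Nat.mod_mod_of_dvd _ (by omega)]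

theorem isCirculant_cycleGraph_even (hm : m % 2 = 1) :
    IsCirculant (SimpleGraph.cycleGraph (m + 3)) 1 (fun v => decide (v.val % 2 = 1)) where
  adj_iff := adj_cycleGraph_iff
  two_ne := one_add_one_ne_zero_fin
  color_iff x y := by
    rw [decide_eq_decide]
    constructor
    · intro hxy
      have := val_add_mod_two hm (y - x) x
      rw [sub_add_cancel] at this
      refine ⟨(y - x).val / 2, ?_⟩
      rw [← sub_eq_iff_eq_add']
      ext
      rw [val_nsmul_two, show 2 * ((y - x).val / 2) = (y - x).val by omega,
        Nat.mod_eq_of_lt (y - x).isLt]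
    · rintro ⟨k, rfl⟩
      induction k with
      | zero => simp
      | succ k ih =>
        have h1 := val_add_mod_two hm (x + k • (1 + 1)) 1
        have h2 := val_add_mod_two hm (x + k • (1 + 1) + 1) 1
        rw [Fin.val_one] at h1 h2
        rw [ih, succ_nsmul, ← add_assoc, ← add_assoc]
        omega

theorem openIn_parity (hm : m % 2 = 1) (i : Bool) :
    openIn (fun v : Fin (m + 3) => decide (v.val % 2 = 1)) i ∅ = (m + 3) / 2 := by
  -- Adding 1 injects each parity class into the other, so the two have equal size.
  have hle : ∀ i, openIn (fun v : Fin (m + 3) => decide (v.val % 2 = 1)) i ∅ ≤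
      openIn (fun v : Fin (m + 3) => decide (v.val % 2 = 1)) (!i) ∅ := fun i => by
    refine Finset.card_le_card_of_injOn (· + 1) (fun u hu => ?_)
      (fun _ _ _ _ e => add_right_cancel e)
    have h1 := val_add_mod_two hm u 1
    rw [Fin.val_one] at h1
    simp only [Finset.coe_filter, Finset.mem_univ, true_and, Set.mem_ofPred_eq] at hu ⊢
    refine ⟨by simp, ?_⟩
    rw [← hu.2, ← decide_not, decide_eq_decide]
    omega
  have hsum : openIn (fun v : Fin (m + 3) => decide (v.val % 2 = 1)) true ∅ +
      openIn (fun v : Fin (m + 3) => decide (v.val % 2 = 1)) false ∅ = m + 3 := by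
    have := Finset.card_filter_add_card_filter_not (s := (Finset.univ : Finset (Fin (m + 3))))
      (fun v => v.val % 2 = 1)
    simpa [openIn] using this
  have h1 := hle true
  have h2 := hle false
  simp only [Bool.not_true, Bool.not_false] at h1 h2
  cases i <;> omega

end CycleGraph

end TotalDominationGame

theorem theoremt (n : ℕ) (hn : 3 ≤ n) :
    TotalDominationGame.IsCritical (SimpleGraph.cycleGraph n) ↔
      n % 6 = 0 ∨ n % 6 = 1 ∨ n % 6 = 3 := by
  obtain ⟨m, rfl⟩ := Nat.exists_eq_add_of_le' hn
  rcases Nat.mod_two_eq_zero_or_one m with hm | hm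
  · exact (TotalDominationGame.isCirculant_cycleGraph_odd hm).isCritical_iff_of_one_class hn
      (by omega) (by simp [TotalDominationGame.openIn]) (by simp [TotalDominationGame.openIn])
  · exact (TotalDominationGame.isCirculant_cycleGraph_even hm).isCritical_iff_of_two_classes
      (L := (m + 3) / 2) (by omega) (by omega) (TotalDominationGame.openIn_parity hm)
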